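/- Let $n \ge 0$ be an integer and let $\mathbf{k}$ be a (totally) ordered field (so $\mathbf{k}$ has characteristic $0$). Write $[n]=\{1,\dots,n\}$. A \emph{face} of $[n]$ is an ordered tuple $F=(F_1,\dots,F_\ell)$ of nonempty, pairwise disjoint subsets (\emph{blocks}) of $[n]$ with union $[n]$; its length is $\ell(F)=\ell$ and its type is the composition $\operatorname{type}F=(|F_1|,\dots,|F_\ell|)$ of $n$. Let $\mathcal F$ be the (finite) set of faces of $[n]$. It is a monoid under $$(F_1,\dots,F_\ell)\cdot(G_1,\dots,G_m)=(F_1\cap G_1,\dots,F_1\cap G_m,\dots,F_\ell\cap G_1,\dots,F_\ell\cap G_m)^{\mathrm{red}},$$ where the superscript means that the empty sets are removed from the list. Let $\mathbf{k}\mathcal F$ be its monoid algebra. A face $F$ is \emph{contained} in a face $G$ if each block of $F$ is a subset of a block of $G$. For a composition $\alpha=(\alpha_1,\dots,\alpha_p)$ of $n$, let $B_\alpha\in\mathbf{k}[S_n]$ be the sum of all permutations $w\in S_n$ whose descent set $\{i\in[n-1] : w(i)>w(i+1)\}$ is contained in $\{\alpha_1+\dots+\alpha_j : 0<j<p\}$,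 and let $\widetilde B_\alpha\in\mathbf{k}\mathcal F$ be the sum of all faces of type $\alpha$. The elements $B_\alpha$ form a basis of their span $\Sigma_n\subseteq\mathbf{k}[S_n]$ (the descent algebra). Let $\rho:\Sigma_n\to\mathbf{k}\mathcal F$ be the $\mathbf{k}$-linear map with $\rho(B_\alpha)=\widetilde B_\alpha$ for all $\alpha$. The permutation $w_0\in S_n$, $w_0(i)=n+1-i$, lies in $\Sigma_n$; set $\widetilde w_0=\rho(w_0)$. Let $\gamma=(\gamma_\alpha)$ be a family of nonnegative elements of $\mathbf{k}$ indexed by the compositions $\alpha$ of $n$, and set $\widetilde B_\gamma=\sum_\alpha\gamma_\alpha\widetilde B_\alpha$. For a face $F$ and a composition $\alpha$ of $n$, let $n_\alpha(F)$ be the number of faces $G$ of type $\alpha$ such that $F$ is contained in $G$, let $\widetilde n_\alpha(F)=(-1)^{n-\ell(F)}n_\alpha(F)$, and define the $\gamma$-weighted signed knapsack number of $F$ to be $\widetilde n_\gamma(F)=\sum_\alpha\gamma_\alpha\widetilde n_\alpha(F)\in\mathbf{k}$. \textbf{Theorem.} The $\mathbf{k}$-linear operator $$\mathbf{k}\mathcal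 F\to\mathbf{k}\mathcal F,\qquad x\mapsto x\,\widetilde w_0\,\widetilde B_\gamma$$ is diagonalizable (over $\mathbf{k}$), and the set of its eigenvalues is exactly $\{\widetilde n_\gamma(F) : F\in\mathcal F\}$. Moreover, for each $\lambda\in\mathbf{k}$, the algebraic multiplicity of $\lambda$ (its multiplicity as a root of the characteristic polynomial) is the number of faces $F\in\mathcal F$ with $\widetilde n_\gamma(F)=\lambda$. -/

import Mathlib

noncomputable section

namespace FaceAlg

/-! ### Set compositions and the face monoid -/

/-- A set composition (a face) of the `n`-element set `Fin n`: an ordered list of nonempty,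
pairwise disjoint subsets whose union is everything. -/
@[ext]
structure Face (n : ℕ) where
  blocks : List (Finset (Fin n))
  nonempty : ∀ A ∈ blocks, A.Nonempty
  disjoint : blocks.Pairwise Disjoint
  cover : ∀ x : Fin n, ∃ A ∈ blocks, x ∈ A

/-- The reduction of a list of sets: remove all empty sets from it. -/
def red {n : ℕ} (l : List (Finset (Fin n))) : List (Finset (Fin n)) :=
  l.filter (fun A => decide A.Nonempty)

/-- The list of all pairwise intersections, in lexicographically increasing order of indices. -/
def meets {n : ℕ} (l m : List (Finset (Fin n))) : List (Finset (Fin n)) :=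
  l.flatMap (fun A => m.map (fun B => A ∩ B))

theorem mem_red {n : ℕ} {l : List (Finset (Fin n))} {A : Finset (Fin n)} :
    A ∈ red l ↔ A ∈ l ∧ A.Nonempty := by
  simp [red]

theorem mem_meets {n : ℕ} {l m : List (Finset (Fin n))} {C : Finset (Fin n)} :
    C ∈ meets l m ↔ ∃ A ∈ l, ∃ B ∈ m, A ∩ B = C := by
  simp [meets]

theorem red_of_nonempty {n : ℕ} {l : List (Finset (Fin n))} (h : ∀ A ∈ l, A.Nonempty) :
    red l = l := by
  simpa [red, List.filter_eq_self] using h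

theorem pairwise_meets {n : ℕ} {l m : List (Finset (Fin n))}
    (hl : l.Pairwise Disjoint) (hm : m.Pairwise Disjoint) : (meets l m).Pairwise Disjoint := by
  rw [meets, List.pairwise_flatMap]
  refine ⟨fun A _ => ?_, hl.imp ?_⟩
  · rw [List.pairwise_map]
    exact hm.imp fun h => h.mono Finset.inter_subset_right Finset.inter_subset_right
  · intro A A' h X hX Y hY
    obtain ⟨B, _, rfl⟩ := List.mem_map.1 hX
    obtain ⟨B', _, rfl⟩ := List.mem_map.1 hY
    exact h.mono Finset.inter_subset_left Finset.inter_subset_left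

theorem red_meets_red_left {n : ℕ} (l m : List (Finset (Fin n))) :
    red (meets (red l) m) = red (meets l m) := by
  induction l with
  | nil => rfl
  | cons A l ih =>
    by_cases hA : A.Nonempty
    · simpa [red, meets, hA] using ih
    · have hA' : A = ∅ := Finset.not_nonempty_iff_eq_empty.1 hA
      subst hA'
      simpa [red, meets] using ih

theorem red_meets_red_right {n : ℕ} (l m : List (Finset (Fin n))) :
    red (meets l (red m)) = red (meets l m) := by
  simp only [red, meets, List.filter_flatMap, List.filter_map, List.filter_filter]
  congr 1
  funext A
  congr 1
  refine List.filter_congr fun B _ => ?_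
  have h : (A ∩ B).Nonempty → B.Nonempty := fun h => h.mono Finset.inter_subset_right
  by_cases h' : (A ∩ B).Nonempty
  · simp [h', h h']
  · simp [h']

theorem meets_assoc {n : ℕ} (l m p : List (Finset (Fin n))) :
    meets (meets l m) p = meets l (meets m p) := by
  simp [meets, List.flatMap_assoc, List.flatMap_map, List.map_flatMap, Finset.inter_assoc,
    Function.comp_def]

namespace Face

/-- The product of faces `F G`: list all `Fᵢ ∩ Gⱼ` lexicographically and remove empty sets. -/
instance instMul (n : ℕ) : Mul (Face n) where
  mul F G :=
    { blocks := red (meets F.blocks G.blocks)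
      nonempty := fun _ hA => (mem_red.1 hA).2
      disjoint := (pairwise_meets F.disjoint G.disjoint).filter _
      cover := fun x => by
        obtain ⟨A, hA, hxA⟩ := F.cover x
        obtain ⟨B, hB, hxB⟩ := G.cover x
        have hx : x ∈ A ∩ B := Finset.mem_inter.2 ⟨hxA, hxB⟩
        exact ⟨A ∩ B, mem_red.2 ⟨mem_meets.2 ⟨A, hA, B, hB, rfl⟩, ⟨x, hx⟩⟩, hx⟩ }

/-- The face with the single block `Fin n` (with no block at all if `n = 0`). -/
instance instOne (n : ℕ) : One (Face n) where
  one :=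
    { blocks := red [Finset.univ]
      nonempty := fun _ hA => (mem_red.1 hA).2
      disjoint := (List.pairwise_singleton _ _).filter _
      cover := fun x => ⟨Finset.univ, mem_red.2 ⟨by simp, ⟨x, by simp⟩⟩, by simp⟩ }

theorem mul_blocks {n : ℕ} (F G : Face n) :
    (F * G).blocks = red (meets F.blocks G.blocks) := rfl

theorem one_blocks (n : ℕ) : (1 : Face n).blocks = red [Finset.univ] := rfl

instance instMonoid (n : ℕ) : Monoid (Face n) where
  mul_assoc F G H := by
    ext1
    simp only [mul_blocks, red_meets_red_left, red_meets_red_right, meets_assoc]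
  one_mul F := by
    ext1
    rw [mul_blocks, one_blocks, red_meets_red_left]
    simpa [meets] using red_of_nonempty F.nonempty
  mul_one F := by
    ext1
    rw [mul_blocks, one_blocks, red_meets_red_right]
    simpa [meets, List.flatMap_singleton'] using red_of_nonempty F.nonempty

theorem blocks_nodup {n : ℕ} (F : Face n) : F.blocks.Nodup := by
  refine F.disjoint.imp_of_mem fun {A B} hA _ h => ?_
  rintro rfl
  exact (F.nonempty _ hA).ne_empty (Finset.disjoint_self_iff_empty _ |>.1 h)

instance instFintype (n : ℕ) : Fintype (Face n) :=
  Fintype.ofInjective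
    (fun F => (⟨F.blocks, F.blocks_nodup⟩ : {l : List (Finset (Fin n)) // l.Nodup}))
    (fun _ _ h => Face.ext (congrArg Subtype.val h))

/-- The number `ℓ(F)` of blocks. -/
def length {n : ℕ} (F : Face n) : ℕ := F.blocks.length

theorem card_foldr_union {n : ℕ} (l : List (Finset (Fin n))) (h : l.Pairwise Disjoint) :
    (l.foldr (· ∪ ·) ∅).card = (l.map Finset.card).sum := by
  induction l with
  | nil => rfl
  | cons A l ih =>
    rw [List.pairwise_cons] at h
    have hd : Disjoint A (l.foldr (· ∪ ·) ∅) := by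
      have h1 := h.1
      clear ih h
      induction l with
      | nil => simp
      | cons B l ih =>
        simp only [List.foldr_cons, Finset.disjoint_union_right]
        exact ⟨h1 B (by simp), ih fun C hC => h1 C (by simp [hC])⟩
    simp only [List.foldr_cons, List.map_cons, List.sum_cons]
    rw [Finset.card_union_of_disjoint hd, ih h.2]

theorem mem_foldr_union {n : ℕ} (l : List (Finset (Fin n))) (x : Fin n) :
    x ∈ l.foldr (· ∪ ·) ∅ ↔ ∃ A ∈ l, x ∈ A := by
  induction l with
  | nil => simp
  | cons A l ih => simp [ih]

/-- The type of a face: the composition of `n` formed by the sizes of its blocks. -/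
def type {n : ℕ} (F : Face n) : Composition n where
  blocks := F.blocks.map Finset.card
  blocks_pos := fun {i} hi => by
    obtain ⟨A, hA, rfl⟩ := List.mem_map.1 hi
    exact (F.nonempty A hA).card_pos
  blocks_sum := by
    rw [← card_foldr_union _ F.disjoint]
    have : F.blocks.foldr (· ∪ ·) ∅ = Finset.univ := by
      ext x
      simpa [mem_foldr_union] using F.cover x
    rw [this, Finset.card_univ, Fintype.card_fin]

/-- `F` is contained in `G`: each block of `F` is a subset of a block of `G`. -/
def Contained {n : ℕ} (F G : Face n) : Prop :=
  ∀ A ∈ F.blocks, ∃ B ∈ G.blocks, A ⊆ B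

end Face

/-! ### The descent algebra -/

/-- The descent set of `w`, with positions numbered from `1`: `i` with
`0 < i < n` is a descent if the `i`-th value of `w` exceeds the next one (in `Fin n`, these are
the values of `w` at `i - 1` and at `i`). -/
def descents {n : ℕ} (w : Equiv.Perm (Fin n)) : Finset (Fin (n + 1)) :=
  open Classical in
  Finset.univ.filter fun i =>
    ∃ (_ : 0 < i.val) (h : i.val < n), w ⟨i.val, h⟩ < w ⟨i.val - 1, by omega⟩

/-- The subset of `{1, …, n - 1}` corresponding to a composition of `n`: its partial sums,
without `0` and `n`. -/
def innerBoundaries {n : ℕ} (α : Composition n) : Finset (Fin (n + 1)) :=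
  α.boundaries.filter fun i => 0 < i.val ∧ i.val < n

/-- `B_I`, the sum of all permutations whose descent set is contained in `I`. -/
def descentBSet (k : Type*) [CommRing k] {n : ℕ} (I : Finset (Fin (n + 1))) :
    MonoidAlgebra k (Equiv.Perm (Fin n)) :=
  ∑ w : Equiv.Perm (Fin n) with descents w ⊆ I, MonoidAlgebra.of k _ w

/-- `B_α` for a composition `α` of `n`. -/
def descentB (k : Type*) [CommRing k] {n : ℕ} (α : Composition n) :
    MonoidAlgebra k (Equiv.Perm (Fin n)) :=
  descentBSet k (innerBoundaries α)

/-- The descent algebra, as the span of the elements `B_α` in the group algebra of `S_n`. -/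
def descentAlgebra (k : Type*) [CommRing k] (n : ℕ) :
    Submodule k (MonoidAlgebra k (Equiv.Perm (Fin n))) :=
  Submodule.span k (Set.range fun α : Composition n => descentB k α)

theorem mem_descents {n : ℕ} {w : Equiv.Perm (Fin n)} {i : Fin (n + 1)} :
    i ∈ descents w ↔
      ∃ (_ : 0 < i.val) (h : i.val < n), w ⟨i.val, h⟩ < w ⟨i.val - 1, by omega⟩ := by
  simp [descents]

theorem mem_innerBoundaries {n : ℕ} {α : Composition n} {i : Fin (n + 1)} :
    i ∈ innerBoundaries α ↔ i ∈ α.boundaries ∧ 0 < i.val ∧ i.val < n := by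
  simp [innerBoundaries]

theorem innerBoundaries_injective (n : ℕ) :
    Function.Injective (innerBoundaries : Composition n → Finset (Fin (n + 1))) := by
  intro α β h
  apply (compositionEquiv n).injective
  apply CompositionAsSet.ext
  change α.boundaries = β.boundaries
  ext i
  by_cases h0 : 0 < i.val
  · by_cases h1 : i.val < n
    · have := Finset.ext_iff.1 h i
      simpa [mem_innerBoundaries, h0, h1] using this
    · have : i = Fin.last n := Fin.ext (by simp; omega)
      subst this
      exact iff_of_true α.toCompositionAsSet.getLast_mem β.toCompositionAsSet.getLast_mem
  · have : i = 0 := Fin.ext (Nat.eq_zero_of_not_pos h0)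
    subst this
    exact iff_of_true α.toCompositionAsSet.zero_mem β.toCompositionAsSet.zero_mem

theorem exists_innerBoundaries_eq {n : ℕ} (I : Finset (Fin (n + 1)))
    (hI : ∀ i ∈ I, 0 < i.val ∧ i.val < n) :
    ∃ α : Composition n, innerBoundaries α = I := by
  let c : CompositionAsSet n :=
    { boundaries := insert 0 (insert (Fin.last n) I)
      zero_mem := by simp
      getLast_mem := by simp }
  refine ⟨c.toComposition, ?_⟩
  ext i
  rw [mem_innerBoundaries, c.toComposition_boundaries]
  constructor
  · rintro ⟨h, h0, h1⟩
    rcases Finset.mem_insert.1 h with rfl | h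
    · simp at h0
    rcases Finset.mem_insert.1 h with rfl | h
    · simp at h1
    exact h
  · intro h
    exact ⟨Finset.mem_insert_of_mem (Finset.mem_insert_of_mem h), hI i h⟩

theorem exists_descents_eq {n : ℕ} (I : Finset (Fin (n + 1)))
    (hI : ∀ i ∈ I, 0 < i.val ∧ i.val < n) :
    ∃ w : Equiv.Perm (Fin n), descents w = I := by
  let c : ℕ → ℕ := fun i => (I.filter fun j => j.val ≤ i).card
  let f : Fin n → ℤ := fun i => (i.val : ℤ) - n * c i.val
  have hf : Function.Injective f := by
    intro a b hab
    have h1 : (a.val : ℤ) - n * c a.val = (b.val : ℤ) - n * c b.val := hab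
    have h2 : (a.val : ℤ) % n = (b.val : ℤ) % n := by
      have := congrArg (· % (n : ℤ)) h1
      simpa using this
    rw [Int.emod_eq_of_lt (by omega) (by have := a.2; omega),
      Int.emod_eq_of_lt (by omega) (by have := b.2; omega)] at h2
    exact Fin.ext (by omega)
  have hs : StrictMono (f ∘ Tuple.sort f) :=
    (Tuple.monotone_sort f).strictMono_of_injective (hf.comp (Tuple.sort f).injective)
  refine ⟨(Tuple.sort f)⁻¹, ?_⟩
  have key : ∀ a b : Fin n, (Tuple.sort f)⁻¹ a < (Tuple.sort f)⁻¹ b ↔ f a < f b := by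
    intro a b
    rw [← hs.lt_iff_lt]
    simp
  ext i
  rw [mem_descents]
  have step : ∀ (h0 : 0 < i.val), c i.val = c (i.val - 1) + if i ∈ I then 1 else 0 := by
    intro h0
    have hsplit : (I.filter fun j => j.val ≤ i.val) =
        (I.filter fun j => j.val ≤ i.val - 1) ∪ (I.filter fun j => j = i) := by
      ext j
      simp only [Finset.mem_filter, Finset.mem_union, ← and_or_left, Fin.ext_iff]
      refine and_congr_right fun _ => ?_
      omega
    have hdisj : Disjoint (I.filter fun j => j.val ≤ i.val - 1) (I.filter fun j => j = i) := by
      rw [Finset.disjoint_filter]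
      rintro j _ hj rfl
      omega
    change (I.filter fun j => j.val ≤ i.val).card = _
    rw [hsplit, Finset.card_union_of_disjoint hdisj, Finset.filter_eq']
    split_ifs <;> simp [c]
  constructor
  · rintro ⟨h0, h1, h⟩
    rw [key] at h
    by_contra hi
    have hc := step h0
    rw [if_neg hi] at hc
    simp only [f, hc, add_zero] at h
    omega
  · intro hi
    obtain ⟨h0, h1⟩ := hI i hi
    refine ⟨h0, h1, ?_⟩
    rw [key]
    have hc := step h0
    rw [if_pos hi] at hc
    simp only [f, hc]
    push_cast
    rw [mul_add]
    omega

theorem coeff_descentBSet (k : Type*) [CommRing k] {n : ℕ} (I : Finset (Fin (n + 1)))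
    (w : Equiv.Perm (Fin n)) :
    (descentBSet k I).coeff w = if descents w ⊆ I then 1 else 0 := by
  classical
  simp [descentBSet, MonoidAlgebra.coeff_sum, Finsupp.finsetSum_apply, Finsupp.single_apply,
    Finset.sum_ite_eq', Finset.mem_filter]

theorem inner_bounds {n : ℕ} (α : Composition n) :
    ∀ i ∈ innerBoundaries α, 0 < i.val ∧ i.val < n :=
  fun _ h => (mem_innerBoundaries.1 h).2

theorem linearIndependent_descentB (k : Type*) [CommRing k] (n : ℕ) :
    LinearIndependent k (fun α : Composition n => descentB k α) := by
  classical
  rw [Fintype.linearIndependent_iff]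
  intro g hg
  have h1 : ∀ β : Composition n,
      ∑ α : Composition n, (if innerBoundaries β ⊆ innerBoundaries α then g α else 0) = 0 := by
    intro β
    obtain ⟨w, hw⟩ := exists_descents_eq _ (inner_bounds β)
    have h2 := congrArg (fun x : MonoidAlgebra k (Equiv.Perm (Fin n)) => x.coeff w) hg
    simpa [MonoidAlgebra.coeff_sum, Finsupp.finsetSum_apply, descentB, coeff_descentBSet, hw]
      using h2
  have h3 : ∀ (m : ℕ) (β : Composition n),
      Fintype.card (Fin (n + 1)) - (innerBoundaries β).card = m → g β = 0 := by
    intro m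
    induction m using Nat.strong_induction_on with
    | _ m ih =>
      intro β hβ
      have h4 := h1 β
      rw [Finset.sum_eq_single β] at h4
      · simpa using h4
      · intro α _ hα
        split_ifs with hsub
        · have hlt : (innerBoundaries β).card < (innerBoundaries α).card :=
            Finset.card_lt_card (hsub.ssubset_of_ne fun h =>
              hα (innerBoundaries_injective n h).symm)
          have hle := Finset.card_le_univ (innerBoundaries α)
          exact ih _ (by omega) α rfl
        · rfl
      · simp
  exact fun β => h3 _ β rfl

/-- The longest permutation `w₀`, sending `i` to `n + 1 - i`, as an element of the group algebra. -/
def longest (k : Type*) [CommRing k] (n : ℕ) : MonoidAlgebra k (Equiv.Perm (Fin n)) :=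
  MonoidAlgebra.of k _ Fin.revPerm

theorem sum_descents_eq_mem (k : Type*) [CommRing k] {n : ℕ} (I : Finset (Fin (n + 1)))
    (hI : ∀ i ∈ I, 0 < i.val ∧ i.val < n) :
    ∑ w : Equiv.Perm (Fin n) with descents w = I, MonoidAlgebra.of k _ w
      ∈ descentAlgebra k n := by
  classical
  induction I using Finset.strongInduction with
  | _ I ih =>
    have h1 : descentBSet k I = ∑ J ∈ I.powerset,
        ∑ w : Equiv.Perm (Fin n) with descents w = J, MonoidAlgebra.of k _ w := by
      rw [descentBSet, ← Finset.sum_fiberwise_of_maps_to (t := I.powerset)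
        (g := fun w : Equiv.Perm (Fin n) => descents w)]
      · refine Finset.sum_congr rfl fun J hJ => ?_
        rw [Finset.filter_filter]
        refine Finset.sum_congr (Finset.filter_congr fun w _ => ?_) fun _ _ => rfl
        constructor
        · exact fun h => h.2
        · exact fun h => ⟨h ▸ Finset.mem_powerset.1 hJ, h⟩
      · intro w hw
        exact Finset.mem_powerset.2 (Finset.mem_filter.1 hw).2
    have h2 : descentBSet k I ∈ descentAlgebra k n := by
      obtain ⟨α, rfl⟩ := exists_innerBoundaries_eq I hI
      exact Submodule.subset_span ⟨α, rfl⟩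
    rw [h1, ← Finset.add_sum_erase _ _ (Finset.mem_powerset_self I)] at h2
    refine (Submodule.add_mem_iff_left _ (Submodule.sum_mem _ fun J hJ => ?_)).1 h2
    have hJ' := Finset.mem_erase.1 hJ
    have hs := Finset.mem_powerset.1 hJ'.2
    exact ih J (hs.ssubset_of_ne hJ'.1) fun i hi => hI i (hs hi)

theorem longest_mem (k : Type*) [CommRing k] (n : ℕ) : longest k n ∈ descentAlgebra k n := by
  classical
  have h := sum_descents_eq_mem k (descents (Fin.revPerm : Equiv.Perm (Fin n)))
    (fun i hi => by
      obtain ⟨h0, h1, _⟩ := mem_descents.1 hi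
      exact ⟨h0, h1⟩)
  have h1 : (Finset.univ.filter fun w : Equiv.Perm (Fin n) =>
      descents w = descents (Fin.revPerm : Equiv.Perm (Fin n))) = {Fin.revPerm} := by
    ext w
    simp only [Finset.mem_filter, Finset.mem_univ, true_and, Finset.mem_singleton]
    constructor
    · intro hw
      have hstep : ∀ i (h0 : 0 < i) (hi : i < n), w ⟨i, hi⟩ < w ⟨i - 1, by omega⟩ := by
        intro i h0 hi
        have h2 : (⟨i, by omega⟩ : Fin (n + 1)) ∈ descents w := by
          rw [hw, mem_descents]
          refine ⟨h0, hi, ?_⟩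
          simp only [Fin.revPerm_apply, Fin.rev_lt_rev, Fin.mk_lt_mk]
          omega
        obtain ⟨_, _, h3⟩ := mem_descents.1 h2
        exact h3
      have hanti : StrictMono (fun i : Fin n => Fin.rev (w i)) := by
        cases n with
        | zero => exact fun a => a.elim0
        | succ m =>
          rw [Fin.strictMono_iff_lt_succ]
          intro i
          rw [Fin.rev_lt_rev]
          exact hstep (i.val + 1) (by omega) (by have := i.2; omega)
      have hid : (fun i : Fin n => Fin.rev (w i)) = id := by
        have hsurj : Function.Surjective (fun i : Fin n => Fin.rev (w i)) :=
          Fin.rev_surjective.comp w.surjective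
        have := Subsingleton.elim (StrictMono.orderIsoOfSurjective _ hanti hsurj)
          (OrderIso.refl (Fin n))
        funext i
        exact congrArg (fun e : Fin n ≃o Fin n => e i) this
      ext i : 1
      have := congrFun hid i
      simp only [id] at this
      rw [Fin.revPerm_apply, ← this, Fin.rev_rev, this]
    · rintro rfl
      rfl
  rw [h1, Finset.sum_singleton] at h
  exact h

/-! ### The face algebra and the map `ρ` -/

/-- The face algebra: the monoid algebra of the monoid of faces. -/
abbrev FaceAlgebra (k : Type*) [CommRing k] (n : ℕ) := MonoidAlgebra k (Face n)

/-- `B̃_α`, the sum of all faces of type `α`. -/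
def faceB (k : Type*) [CommRing k] {n : ℕ} (α : Composition n) : FaceAlgebra k n :=
  ∑ F : Face n with F.type = α, MonoidAlgebra.of k _ F

/-- The basis of the descent algebra formed by the elements `B_α`. -/
def descentBasis (k : Type*) [CommRing k] (n : ℕ) :
    Module.Basis (Composition n) k (descentAlgebra k n) :=
  Module.Basis.span (linearIndependent_descentB k n)

/-- The linear map `ρ` from the descent algebra to the face algebra with `ρ(B_α) = B̃_α` (its
values in fact lie in the subalgebra of `S_n`-invariants). -/
def rho (k : Type*) [CommRing k] (n : ℕ) : descentAlgebra k n →ₗ[k] FaceAlgebra k n :=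
  (descentBasis k n).constr k (fun α => faceB k α)

theorem rho_descentB (k : Type*) [CommRing k] {n : ℕ} (α : Composition n) :
    rho k n ⟨descentB k α, Submodule.subset_span ⟨α, rfl⟩⟩ = faceB k α := by
  have h : descentBasis k n α = ⟨descentB k α, Submodule.subset_span ⟨α, rfl⟩⟩ :=
    Module.Basis.span_apply (linearIndependent_descentB k n) α
  rw [← h, rho, Module.Basis.constr_basis]

/-- `w̃₀ = ρ(w₀)`. -/
def longestTilde (k : Type*) [CommRing k] (n : ℕ) : FaceAlgebra k n :=
  rho k n ⟨longest k n, longest_mem k n⟩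

/-- `B̃_γ = ∑_α γ_α B̃_α`. -/
def faceBWeighted {k : Type*} [CommRing k] {n : ℕ} (γ : Composition n → k) : FaceAlgebra k n :=
  ∑ α : Composition n, γ α • faceB k α

/-- The linear operator `x ↦ x w̃₀ B̃_γ` on the face algebra. -/
def rightMulOperator {k : Type*} [CommRing k] {n : ℕ} (γ : Composition n → k) :
    Module.End k (FaceAlgebra k n) :=
  LinearMap.mulRight k (longestTilde k n * faceBWeighted γ)

/-! ### Knapsack numbers -/

/-- The knapsack number `n_α(F)`: the number of faces `G` of type `α` in which `F` is contained. -/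
def knapsack {n : ℕ} (α : Composition n) (F : Face n) : ℕ :=
  Nat.card {G : Face n // F.Contained G ∧ G.type = α}

/-- The signed knapsack number `(-1)^(n - ℓ(F)) n_α(F)`; note that `ℓ(F) ≤ n`, so the subtraction
of natural numbers is not truncated. -/
def signedKnapsack {n : ℕ} (α : Composition n) (F : Face n) : ℤ :=
  (-1) ^ (n - F.length) * (knapsack α F : ℤ)

/-- The `γ`-weighted signed knapsack number `∑_α γ_α ñ_α(F)`. -/
def weightedSignedKnapsack {k : Type*} [CommRing k] {n : ℕ} (γ : Composition n → k)
    (F : Face n) : k :=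
  ∑ α : Composition n, γ α * (signedKnapsack α F : k)

/-! ### Diagonalizability -/

/-- An endomorphism of a vector space is diagonalizable if there is a basis of eigenvectors. -/
def IsDiagonalizable.{u, v} {k : Type u} {V : Type v} [Field k] [AddCommGroup V] [Module k V]
    (f : Module.End k V) : Prop :=
  ∃ (ι : Type v) (b : Module.Basis ι k V), ∀ i : ι, ∃ c : k, f (b i) = c • b i

end FaceAlg

end

/-! Write `T` for the operator and `N(F)` for the unsigned weighted knapsack number
`weightedKnapsack γ F`.

Characteristic polynomial. A product `F * G` either equals `F` or has strictly fewer pairs of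
elements in a common block. So every right multiplication is triangular in the basis of faces, and
its diagonal coefficients are multiplicative (`coeff_of_mul_mul`). The diagonal coefficient at `F`
is `(-1)^(n - ℓ(F))` for `w̃₀` and `N(F)` for `B̃_γ`, and their product is the signed number.

Involution. The elements `chooseSum n c = ∑ binom(c, ℓ(F)) F` satisfy `chooseSum n c * chooseSum n d
= chooseSum n (c * d)`. For natural `c` and `d` this pairs functions into two chains into one
function to their lexicographic product; the general case is a polynomial identity. Since `w̃₀ =
(-1)^n • chooseSum n (-1)`, it follows that `w̃₀² = 1`.

Diagonalizability. As `γ ≥ 0`, `N` weakly increases under right multiplication, so the faces with `N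
≥ c` span a right ideal, and so do those with `N > c`. If `γ` is nonzero at the type of `G` and `F *
G ≠ F`, then `N(F * G) > N(F)`, because `G` contains `F * G` but does not contain `F`. Hence on the
quotient of these ideals `B̃_γ` acts as the scalar `c`, and `T` acts as `c` times an involution.
Thus `(T - c)(T + c)`, or `T` alone if `c = 0`, moves one step down the filtration. Different values
`c ≥ 0` give disjoint root sets `{c, -c}`, so a product of distinct linear factors annihilates `T`.
-/

noncomputable section

namespace FaceAlg

/-! ### Faces and their underlying equivalence relations. -/

namespace Face

variable {n : ℕ}

/-- The pairs of elements that lie in a common block of `F`. -/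
def sameBlock (F : Face n) : Set (Fin n × Fin n) :=
  {p | ∃ A ∈ F.blocks, p.1 ∈ A ∧ p.2 ∈ A}

theorem mem_sameBlock {F : Face n} {x y : Fin n} :
    (x, y) ∈ F.sameBlock ↔ ∃ A ∈ F.blocks, x ∈ A ∧ y ∈ A := Iff.rfl

theorem eq_of_mem_blocks {F : Face n} {A B : Finset (Fin n)} {x : Fin n}
    (hA : A ∈ F.blocks) (hB : B ∈ F.blocks) (hxA : x ∈ A) (hxB : x ∈ B) : A = B := by
  by_contra h
  have : Disjoint A B := F.disjoint.forall hA hB h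
  exact Finset.disjoint_left.1 this hxA hxB

/-- Containment becomes inclusion of relations, and by `sameBlock_mul` the product becomes
intersection; monotonicity statements are then set theory. -/
theorem contained_iff_sameBlock_subset {F G : Face n} :
    F.Contained G ↔ F.sameBlock ⊆ G.sameBlock := by
  constructor
  · rintro h ⟨x, y⟩ ⟨A, hA, hx, hy⟩
    obtain ⟨B, hB, hAB⟩ := h A hA
    exact ⟨B, hB, hAB hx, hAB hy⟩
  · intro h A hA
    obtain ⟨x, hx⟩ := F.nonempty A hA
    obtain ⟨B, hB, hxB⟩ := G.cover x
    refine ⟨B, hB, fun y hy => ?_⟩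
    obtain ⟨B', hB', hx', hy'⟩ := h (mem_sameBlock.2 ⟨A, hA, hx, hy⟩)
    rwa [eq_of_mem_blocks hB hB' hxB hx']

theorem sameBlock_mul (F G : Face n) : (F * G).sameBlock = F.sameBlock ∩ G.sameBlock := by
  ext ⟨x, y⟩
  simp only [Set.mem_inter_iff, mem_sameBlock, mul_blocks, mem_red, mem_meets]
  constructor
  · rintro ⟨_, ⟨⟨A, hA, B, hB, rfl⟩, _⟩, hx, hy⟩
    rw [Finset.mem_inter] at hx hy
    exact ⟨⟨A, hA, hx.1, hy.1⟩, ⟨B, hB, hx.2, hy.2⟩⟩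
  · rintro ⟨⟨A, hA, hx, hy⟩, ⟨B, hB, hx', hy'⟩⟩
    have h : x ∈ A ∩ B := Finset.mem_inter.2 ⟨hx, hx'⟩
    exact ⟨A ∩ B, ⟨⟨A, hA, B, hB, rfl⟩, ⟨x, h⟩⟩, h, Finset.mem_inter.2 ⟨hy, hy'⟩⟩

theorem red_map_inter_eq_singleton {A B : Finset (Fin n)} (hA : A.Nonempty) (hAB : A ⊆ B) :
    ∀ {m : List (Finset (Fin n))}, m.Pairwise Disjoint → B ∈ m → red (m.map (A ∩ ·)) = [A] := by
  intro m
  induction m with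
  | nil => simp
  | cons C m ih =>
    intro hm hB
    rw [List.pairwise_cons] at hm
    rcases List.mem_cons.1 hB with rfl | hB
    · have h0 : red (m.map (A ∩ ·)) = [] := by
        simp only [red, List.filter_eq_nil_iff, List.mem_map, decide_eq_true_eq]
        rintro _ ⟨D, hD, rfl⟩
        rw [Finset.not_nonempty_iff_eq_empty, ← Finset.disjoint_iff_inter_eq_empty]
        exact (hm.1 D hD).mono_left hAB
      have h1 : A ∩ B = A := Finset.inter_eq_left.2 hAB
      simp only [red, List.map_cons, h1] at h0 ⊢
      rw [List.filter_cons_of_pos (by simpa using hA), h0]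
    · have h1 : A ∩ C = ∅ := by
        rw [← Finset.disjoint_iff_inter_eq_empty]
        exact ((hm.1 B hB).mono_right hAB).symm
      have := ih hm.2 hB
      simp only [red, List.map_cons, h1] at this ⊢
      rw [List.filter_cons_of_neg (by simp), this]

/-- If `F` is contained in `G`, each block of `F` meets exactly one block of `G`, in the whole of
itself, so neither the blocks nor their order change. -/
theorem mul_eq_left_iff_contained {F G : Face n} : F * G = F ↔ F.Contained G := by
  constructor
  · intro h
    rw [contained_iff_sameBlock_subset]
    have := sameBlock_mul F G
    rw [h] at this
    exact Set.left_eq_inter.1 this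
  · intro h
    ext1
    rw [mul_blocks, meets, red, List.filter_flatMap]
    have : ∀ A ∈ F.blocks,
        (G.blocks.map (A ∩ ·)).filter (fun A => decide A.Nonempty) = [A] := by
      intro A hA
      obtain ⟨B, hB, hAB⟩ := h A hA
      exact red_map_inter_eq_singleton (F.nonempty A hA) hAB G.disjoint hB
    rw [List.flatMap_congr this, List.flatMap_singleton']

theorem mul_contained_right (F G : Face n) : (F * G).Contained G := by
  rw [contained_iff_sameBlock_subset, sameBlock_mul]
  exact Set.inter_subset_right

theorem Contained.mul_right {F H : Face n} (h : F.Contained H) (G : Face n) :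
    (F * G).Contained H := by
  rw [contained_iff_sameBlock_subset] at h ⊢
  rw [sameBlock_mul]
  exact Set.inter_subset_left.trans h

/-- Right multiplication never merely reorders blocks: equal relations would force `F` to be
contained in `G`, hence `F * G = F`. This is the source of triangularity. -/
theorem ncard_sameBlock_mul_lt {F G : Face n} (h : F * G ≠ F) :
    (F * G).sameBlock.ncard < F.sameBlock.ncard := by
  refine Set.ncard_lt_ncard ?_ (Set.toFinite _)
  rw [sameBlock_mul]
  refine Set.inter_subset_left.ssubset_of_ne fun h' => h ?_
  rw [mul_eq_left_iff_contained, contained_iff_sameBlock_subset]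
  exact Set.inter_eq_left.1 h'

end Face

/-! ### Faces given by functions -/

section Fibers

variable {n : ℕ} {ι κ : Type*} [DecidableEq ι] [DecidableEq κ]

/-- The list of fibres of `f`, in the order prescribed by `l`. -/
def fibers (l : List ι) (f : Fin n → ι) : List (Finset (Fin n)) :=
  l.map fun a => Finset.univ.filter fun x => f x = a

/-- The face formed by the nonempty fibres of `f`, in the order prescribed by `l`. -/
def Face.ofFun (l : List ι) (hl : l.Nodup) (hl' : ∀ a, a ∈ l) (f : Fin n → ι) : Face n where
  blocks := red (fibers l f)
  nonempty := fun _ hA => (mem_red.1 hA).2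
  disjoint := by
    refine List.Pairwise.filter _ ?_
    rw [fibers, List.pairwise_map]
    refine hl.imp fun {a b} hab => ?_
    rw [Finset.disjoint_filter]
    rintro x _ rfl
    exact hab
  cover := fun x => by
    have hx : x ∈ Finset.univ.filter fun y => f y = f x := by simp
    exact ⟨_, mem_red.2 ⟨List.mem_map.2 ⟨f x, hl' _, rfl⟩, ⟨x, hx⟩⟩, hx⟩

theorem mem_sameBlock_ofFun {l : List ι} (hl : l.Nodup) (hl' : ∀ a, a ∈ l) (f : Fin n → ι)
    {x y : Fin n} : (x, y) ∈ (Face.ofFun l hl hl' f).sameBlock ↔ f x = f y := by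
  rw [Face.mem_sameBlock]
  constructor
  · rintro ⟨A, hA, hx, hy⟩
    obtain ⟨a, _, rfl⟩ := List.mem_map.1 (mem_red.1 hA).1
    simp only [Finset.mem_filter, Finset.mem_univ, true_and] at hx hy
    rw [hx, hy]
  · intro h
    obtain ⟨A, hA, hx⟩ := (Face.ofFun l hl hl' f).cover x
    refine ⟨A, hA, hx, ?_⟩
    obtain ⟨a, _, rfl⟩ := List.mem_map.1 (mem_red.1 hA).1
    simp only [Finset.mem_filter, Finset.mem_univ, true_and] at hx ⊢
    rw [← h, hx]

/-- A fibre of the paired function is an intersection of fibres, and the product list runs through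
pairs in the same lexicographic order as `meets`. -/
theorem meets_fibers (l : List ι) (m : List κ) (f : Fin n → ι) (g : Fin n → κ) :
    meets (fibers l f) (fibers m g) = fibers (l ×ˢ m) (fun x => (f x, g x)) := by
  simp only [meets, fibers, SProd.sprod, List.product, List.flatMap_map, List.map_flatMap,
    List.map_map, Function.comp_def, Prod.mk.injEq, Finset.filter_and]

theorem ofFun_mul_ofFun {l : List ι} (hl : l.Nodup) (hl' : ∀ a, a ∈ l) {m : List κ}
    (hm : m.Nodup) (hm' : ∀ a, a ∈ m) (f : Fin n → ι) (g : Fin n → κ) :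
    Face.ofFun l hl hl' f * Face.ofFun m hm hm' g =
      Face.ofFun (l ×ˢ m) (hl.product hm) (fun a => List.mem_product.2 ⟨hl' a.1, hm' a.2⟩)
        (fun x => (f x, g x)) := by
  ext1
  rw [Face.mul_blocks]
  simp only [Face.ofFun, red_meets_red_left, red_meets_red_right, meets_fibers]

/-- The lists of length `N` whose reduction is the given list of nonempty sets. -/
def paddings : ℕ → List (Finset (Fin n)) → Finset (List (Finset (Fin n)))
  | 0, [] => {[]}
  | 0, _ :: _ => ∅
  | N + 1, [] => (paddings N []).image (List.cons ∅)
  | N + 1, b :: B => (paddings N (b :: B)).image (List.cons ∅) ∪ (paddings N B).image (List.cons b)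

/-- Pascal's recursion, according to whether the first entry is empty or is the first set of `B`. -/
theorem card_paddings (N : ℕ) (B : List (Finset (Fin n))) (hB : ∀ b ∈ B, b.Nonempty) :
    (paddings N B).card = N.choose B.length := by
  have hinj (b : Finset (Fin n)) : Function.Injective (List.cons b) := List.cons_injective
  induction N generalizing B with
  | zero => cases B <;> simp [paddings]
  | succ N ih =>
    cases B with
    | nil => rw [paddings, Finset.card_image_of_injective _ (hinj _), ih _ hB]; simp
    | cons b B =>
      have hb := hB b (by simp)
      rw [paddings, Finset.card_union_of_disjoint, Finset.card_image_of_injective _ (hinj _),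
        Finset.card_image_of_injective _ (hinj _), ih _ hB, ih _ fun c hc => hB c (by simp [hc])]
      · simp [Nat.choose_succ_succ, add_comm]
      · rw [Finset.disjoint_left]
        intro x hx hx'
        obtain ⟨y, _, rfl⟩ := Finset.mem_image.1 hx
        obtain ⟨z, _, h⟩ := Finset.mem_image.1 hx'
        exact hb.ne_empty (List.cons.inj h).1

theorem mem_paddings {N : ℕ} {B m : List (Finset (Fin n))} (hB : ∀ b ∈ B, b.Nonempty) :
    m ∈ paddings N B ↔ m.length = N ∧ red m = B := by
  induction N generalizing B m with
  | zero =>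
    cases B with
    | nil => cases m <;> simp [paddings, red]
    | cons b B => cases m <;> simp [paddings, red]
  | succ N ih =>
    cases m with
    | nil => cases B <;> simp [paddings]
    | cons a m =>
      have hcons : ∀ c x, (List.cons c x = a :: m ↔ c = a ∧ x = m) := by simp
      cases B with
      | nil =>
        simp only [paddings, Finset.mem_image, ih hB, hcons]
        by_cases ha : a.Nonempty
        · simp [red, ha, ha.ne_empty.symm]
        · rw [Finset.not_nonempty_iff_eq_empty] at ha
          subst ha
          simp [red]
      | cons b B =>
        simp only [paddings, Finset.mem_union, Finset.mem_image, ih hB,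
          ih (B := B) fun c hc => hB c (by simp [hc]), hcons]
        by_cases ha : a.Nonempty
        · simp [red, ha, ha.ne_empty.symm]
          grind
        · rw [Finset.not_nonempty_iff_eq_empty] at ha
          subst ha
          have := (hB b (by simp)).ne_empty
          simp [red, this]

theorem fibers_injective {l : List ι} (hl' : ∀ a, a ∈ l) :
    Function.Injective (fibers l : (Fin n → ι) → _) := by
  intro f g h
  funext x
  have h1 := List.map_inj_left.1 h (f x) (hl' _)
  have h2 : x ∈ Finset.univ.filter fun y => f y = f x := by simp
  rw [h1] at h2
  simpa using (Finset.mem_filter.1 h2).2.symm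

theorem exists_fibers_eq {l : List ι} (hl : l.Nodup) (F : Face n)
    {m : List (Finset (Fin n))} (hm : m.length = l.length) (hr : red m = F.blocks) :
    ∃ f : Fin n → ι, fibers l f = m := by
  -- Inserting empty sets keeps a list pairwise disjoint, so each `x` lies in exactly one entry of
  -- `m`; its position determines the value of `f` at `x`.
  have hd : m.Pairwise Disjoint := by
    have h := F.disjoint
    rw [← hr, red, List.pairwise_filter] at h
    refine h.imp fun {A B} hAB => ?_
    by_cases hA : A.Nonempty
    · by_cases hB : B.Nonempty
      · exact hAB (by simpa using hA) (by simpa using hB)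
      · rw [Finset.not_nonempty_iff_eq_empty.1 hB]; exact Finset.disjoint_empty_right _
    · rw [Finset.not_nonempty_iff_eq_empty.1 hA]; exact Finset.disjoint_empty_left _
  have hex : ∀ x, ∃ i, ∃ h : i < m.length, x ∈ m[i] := by
    intro x
    obtain ⟨A, hA, hx⟩ := F.cover x
    rw [← hr, mem_red] at hA
    obtain ⟨i, hi, rfl⟩ := List.getElem_of_mem hA.1
    exact ⟨i, hi, hx⟩
  choose i hi hx using hex
  refine ⟨fun x => l[i x]'(hm ▸ hi x), List.ext_getElem (by simp [fibers, hm]) fun j h1 h2 => ?_⟩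
  ext x
  simp only [fibers, List.getElem_map, Finset.mem_filter, Finset.mem_univ, true_and]
  rw [hl.getElem_inj_iff]
  constructor
  · rintro rfl
    exact hx x
  · intro h
    rw [List.pairwise_iff_getElem] at hd
    rcases lt_trichotomy (i x) j with hlt | heq | hgt
    · exact absurd h (Finset.disjoint_left.1 (hd _ _ (hi x) h2 hlt) (hx x))
    · exact heq
    · exact absurd (hx x) (Finset.disjoint_left.1 (hd _ _ h2 (hi x) hgt) h)

-- A function is determined by its list of fibres, which is the block list of `F` padded with empty
-- sets to the length of `l`. The binomial coefficient counts the positions of the nonempty fibres.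
open Classical in
theorem card_ofFun_eq [Fintype ι] {l : List ι} (hl : l.Nodup) (hl' : ∀ a, a ∈ l) (F : Face n) :
    (Finset.univ.filter fun f : Fin n → ι => Face.ofFun l hl hl' f = F).card =
      l.length.choose F.length := by
  rw [Face.length, ← card_paddings _ _ F.nonempty]
  refine Finset.card_nbij (fibers l) ?_ ((fibers_injective hl').injOn) ?_
  · intro f hf
    have hf := (Finset.mem_filter.1 hf).2
    refine (mem_paddings F.nonempty).2 ⟨by simp [fibers], ?_⟩
    rw [← hf]
    rfl
  · intro m hm
    obtain ⟨h1, h2⟩ := (mem_paddings F.nonempty).1 hm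
    obtain ⟨f, rfl⟩ := exists_fibers_eq hl F h1 h2
    exact ⟨f, by simpa using Face.ext h2, rfl⟩

-- The condition says that `f` is constant on each block of `F`, and its values on the blocks can be
-- chosen freely.
open Classical in
theorem card_mul_ofFun_eq [Fintype ι] {l : List ι} (hl : l.Nodup) (hl' : ∀ a, a ∈ l)
    (F : Face n) :
    (Finset.univ.filter fun f : Fin n → ι => F * Face.ofFun l hl hl' f = F).card =
      Fintype.card ι ^ F.length := by
  have hcov := F.cover
  choose b hb hxb using hcov
  let π : Fin n → {A // A ∈ F.blocks} := fun x => ⟨b x, hb x⟩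
  have hπ : Function.Surjective π := by
    rintro ⟨A, hA⟩
    obtain ⟨x, hx⟩ := F.nonempty A hA
    exact ⟨x, Subtype.ext (Face.eq_of_mem_blocks (hb x) hA (hxb x) hx)⟩
  have hset : (Finset.univ.filter fun f : Fin n → ι => F * Face.ofFun l hl hl' f = F) =
      Finset.univ.image fun g : {A // A ∈ F.blocks} → ι => g ∘ π := by
    ext f
    simp only [Finset.mem_filter, Finset.mem_univ, true_and, Finset.mem_image,
      Face.mul_eq_left_iff_contained, Face.contained_iff_sameBlock_subset]
    constructor
    · intro h
      have hf : Function.FactorsThrough f π := by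
        intro x y hxy
        rw [← mem_sameBlock_ofFun hl hl' f]
        refine h (Face.mem_sameBlock.2 ⟨b x, hb x, hxb x, ?_⟩)
        rw [show b x = b y from congrArg Subtype.val hxy]
        exact hxb y
      exact ⟨fun A => f (hπ A).choose, funext fun x => hf (hπ (π x)).choose_spec⟩
    · rintro ⟨g, rfl⟩ ⟨x, y⟩ ⟨A, hA, hx, hy⟩
      rw [mem_sameBlock_ofFun]
      have : π x = π y := Subtype.ext <|
        (Face.eq_of_mem_blocks (hb x) hA (hxb x) hx).trans
          (Face.eq_of_mem_blocks (hb y) hA (hxb y) hy).symm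
      simp only [Function.comp, this]
  rw [hset, Finset.card_image_of_injective _ hπ.injective_comp_right, Finset.card_univ,
    Fintype.card_fun, Face.length]
  congr 1
  rw [Fintype.card_of_subtype F.blocks.toFinset (by simp),
    List.toFinset_card_of_nodup F.blocks_nodup]

end Fibers

end FaceAlg
end

noncomputable section

namespace FaceAlg

/-! ### Binomial coefficients as polynomials. -/

section Binomial

open Polynomial

variable (k : Type*) [Field k] [CharZero k]

/-- The binomial coefficient `X.choose j` as a polynomial. -/
def choosePoly (j : ℕ) : k[X] := C ((j.factorial : k)⁻¹) * descPochhammer k j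

theorem choosePoly_eval_natCast (j N : ℕ) : (choosePoly k j).eval (N : k) = N.choose j := by
  have : (j.factorial : k) ≠ 0 := Nat.cast_ne_zero.2 j.factorial_ne_zero
  rw [choosePoly, eval_mul, eval_C, descPochhammer_eval_eq_descFactorial,
    Nat.descFactorial_eq_factorial_mul_choose, Nat.cast_mul, inv_mul_cancel_left₀ this]

theorem choosePoly_eval_neg_one (j : ℕ) : (choosePoly k j).eval (-1) = (-1) ^ j := by
  have : (j.factorial : k) ≠ 0 := Nat.cast_ne_zero.2 j.factorial_ne_zero
  have h := ascPochhammer_eval_neg_eq_descPochhammer k (-1) j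
  rw [neg_neg, ascPochhammer_eval_one] at h
  rw [choosePoly, eval_mul, eval_C, inv_mul_eq_iff_eq_mul₀ this, h, mul_right_comm, ← mul_pow]
  simp

variable {k}

theorem eq_of_eval_natCast_eq {p q : k[X]} (h : ∀ N : ℕ, p.eval (N : k) = q.eval (N : k)) :
    p = q := by
  refine eq_of_infinite_eval_eq p q ((Set.infinite_range_of_injective
    (Nat.cast_injective (R := k))).mono ?_)
  rintro _ ⟨N, rfl⟩
  exact h N

end Binomial

/-! ### The multiplicative family `chooseSum`. -/

section Weights

open Polynomial
open MonoidAlgebra (of)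

variable {k : Type*} [Field k] {n : ℕ}

/-- The element `∑ binom(c, ℓ(F)) F` of the face algebra; for natural numbers `c = N`, it is the
sum of the faces of all functions from `Fin n` to an `N`-element chain. -/
def chooseSum (n : ℕ) (c : k) : FaceAlgebra k n :=
  ∑ F : Face n, (choosePoly k F.length).eval c • of k _ F

theorem coeff_chooseSum (c : k) (H : Face n) :
    (chooseSum n c).coeff H = (choosePoly k H.length).eval c := by
  classical
  simp [chooseSum, MonoidAlgebra.coeff_sum, Finsupp.finsetSum_apply, Finsupp.single_apply]

/-- Coefficients depend polynomially on `c`, so identities between them need only be checked at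
natural numbers. -/
theorem coeff_chooseSum_mul (c : k) (x : FaceAlgebra k n) (H : Face n) :
    (chooseSum n c * x).coeff H =
      (∑ F : Face n, choosePoly k F.length * C ((of k _ F * x).coeff H)).eval c := by
  simp only [chooseSum, Finset.sum_mul, smul_mul_assoc, MonoidAlgebra.coeff_sum,
    Finsupp.finsetSum_apply, MonoidAlgebra.coeff_smul, Finsupp.smul_apply, smul_eq_mul,
    eval_finsetSum, eval_mul, eval_C]

theorem coeff_mul_chooseSum (c : k) (x : FaceAlgebra k n) (H : Face n) :
    (x * chooseSum n c).coeff H =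
      (∑ F : Face n, choosePoly k F.length * C ((x * of k _ F).coeff H)).eval c := by
  simp only [chooseSum, Finset.mul_sum, mul_smul_comm, MonoidAlgebra.coeff_sum,
    Finsupp.finsetSum_apply, MonoidAlgebra.coeff_smul, Finsupp.smul_apply, smul_eq_mul,
    eval_finsetSum, eval_mul, eval_C]

variable [CharZero k]

theorem chooseSum_length {ι : Type*} [DecidableEq ι] [Fintype ι] {l : List ι} (hl : l.Nodup)
    (hl' : ∀ a, a ∈ l) :
    chooseSum n (l.length : k) = ∑ f : Fin n → ι, of k _ (Face.ofFun l hl hl' f) := by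
  classical
  rw [chooseSum, ← Finset.sum_fiberwise (s := Finset.univ) (g := Face.ofFun l hl hl')]
  refine Finset.sum_congr rfl fun F _ => ?_
  rw [choosePoly_eval_natCast, ← card_ofFun_eq hl hl', Finset.sum_congr rfl
    (g := fun _ => of k _ F) fun f hf => by rw [(Finset.mem_filter.1 hf).2],
    Finset.sum_const, Nat.cast_smul_eq_nsmul]

theorem chooseSum_natCast (N : ℕ) :
    chooseSum n (N : k) = ∑ f : Fin n → Fin N,
      of k _ (Face.ofFun (List.finRange N) (List.nodup_finRange N) List.mem_finRange f) := by
  rw [← chooseSum_length, List.length_finRange]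

theorem chooseSum_mul_natCast (N M : ℕ) :
    chooseSum n (N : k) * chooseSum n (M : k) = chooseSum n ((N : k) * M) := by
  have h := chooseSum_length (k := k) (n := n)
    ((List.nodup_finRange N).product (List.nodup_finRange M))
    (fun a => List.mem_product.2 ⟨List.mem_finRange a.1, List.mem_finRange a.2⟩)
  have hlen : ((List.finRange N ×ˢ List.finRange M).length : k) = N * M := by
    rw [List.length_product, List.length_finRange, List.length_finRange, Nat.cast_mul]
  rw [← hlen, h, chooseSum_natCast, chooseSum_natCast, Finset.sum_mul_sum,
    ← Fintype.sum_prod_type', ← (Equiv.arrowProdEquivProdArrow _ _ _).sum_comp]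
  refine Finset.sum_congr rfl fun f _ => ?_
  rw [← map_mul, ofFun_mul_ofFun]
  rfl

/-- Extends the identity from natural numbers one parameter at a time: first `c` with `M` natural,
then `d` with `c` arbitrary. -/
theorem chooseSum_mul_chooseSum (c d : k) :
    chooseSum n c * chooseSum n d = chooseSum n (c * d) := by
  have h1 (M : ℕ) (c : k) : chooseSum n c * chooseSum n (M : k) = chooseSum n (c * M) := by
    refine MonoidAlgebra.ext (Finsupp.ext fun H => ?_)
    have : (choosePoly k H.length).eval (c * M) =
        ((choosePoly k H.length).comp (X * C (M : k))).eval c := by simp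
    rw [coeff_chooseSum_mul, coeff_chooseSum, this]
    refine congrArg (eval c) (eq_of_eval_natCast_eq fun N => ?_)
    rw [← coeff_chooseSum_mul, chooseSum_mul_natCast, coeff_chooseSum]
    simp
  refine MonoidAlgebra.ext (Finsupp.ext fun H => ?_)
  have : (choosePoly k H.length).eval (c * d) =
      ((choosePoly k H.length).comp (C c * X)).eval d := by simp
  rw [coeff_mul_chooseSum, coeff_chooseSum, this]
  refine congrArg (eval d) (eq_of_eval_natCast_eq fun M => ?_)
  rw [← coeff_mul_chooseSum, h1, coeff_chooseSum]
  simp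

theorem chooseSum_one : chooseSum n (1 : k) = 1 := by
  rw [← Nat.cast_one, chooseSum_natCast, Fintype.sum_unique, ← map_one (of k (Face n))]
  congr 1
  ext1
  rw [Face.one_blocks]
  simp only [Face.ofFun, fibers, List.finRange_succ, List.finRange_zero, List.map_nil,
    List.map_cons]
  congr 2
  ext x
  simp [Subsingleton.elim _ (0 : Fin 1)]

theorem coeff_of_mul_chooseSum (c : k) (F : Face n) :
    (of k _ F * chooseSum n c).coeff F = c ^ F.length := by
  classical
  have : c ^ F.length = (X ^ F.length : k[X]).eval c := by simp
  rw [coeff_mul_chooseSum, this]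
  refine congrArg (eval c) (eq_of_eval_natCast_eq fun N => ?_)
  rw [← coeff_mul_chooseSum, chooseSum_natCast, Finset.mul_sum]
  have h := card_mul_ofFun_eq (List.nodup_finRange N) List.mem_finRange F
  rw [Fintype.card_fin] at h
  simp only [← map_mul]
  simp only [MonoidAlgebra.coeff_sum, Finsupp.finsetSum_apply, MonoidAlgebra.of_apply,
    MonoidAlgebra.coeff_single, Finsupp.single_apply]
  rw [Finset.sum_boole, h]
  simp

end Weights

/-! ### The element `w̃₀` -/

section Longest

open MonoidAlgebra

variable {n : ℕ}

theorem eq_revPerm_of_descents {w : Equiv.Perm (Fin n)}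
    (hw : ∀ i : Fin (n + 1), 0 < i.val ∧ i.val < n → i ∈ descents w) : w = Fin.revPerm := by
  have hanti : StrictMono (fun i : Fin n => Fin.rev (w i)) := by
    cases n with
    | zero => exact fun a => a.elim0
    | succ m =>
      rw [Fin.strictMono_iff_lt_succ]
      intro i
      rw [Fin.rev_lt_rev]
      obtain ⟨_, _, h⟩ := mem_descents.1 (hw ⟨i.val + 1, by omega⟩ ⟨by simp, by simp⟩)
      exact h
  have hsurj : Function.Surjective (fun i : Fin n => Fin.rev (w i)) :=
    Fin.rev_surjective.comp w.surjective
  have hid := Subsingleton.elim (StrictMono.orderIsoOfSurjective _ hanti hsurj)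
    (OrderIso.refl (Fin n))
  ext i : 1
  have h : Fin.rev (w i) = i := congrArg (fun e : Fin n ≃o Fin n => e i) hid
  rw [Fin.revPerm_apply, ← Fin.rev_rev (w i), h]

theorem mem_descents_revPerm (i : Fin (n + 1)) :
    i ∈ descents (Fin.revPerm : Equiv.Perm (Fin n)) ↔ 0 < i.val ∧ i.val < n := by
  rw [mem_descents]
  constructor
  · rintro ⟨h0, h1, _⟩
    exact ⟨h0, h1⟩
  · rintro ⟨h0, h1⟩
    refine ⟨h0, h1, ?_⟩
    simp only [Fin.revPerm_apply, Fin.rev_lt_rev, Fin.mk_lt_mk]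
    omega

theorem card_compl_boundaries (α : Composition n) : (α.boundariesᶜ).card = n - α.length := by
  rw [Finset.card_compl, α.card_boundaries_eq_succ_length, Fintype.card_fin]
  omega

/-- The alternating sum over all subsets of the interior non-descents `D` of `w` vanishes unless `D`
is empty, that is, unless every interior position is a descent. -/
theorem sum_neg_one_pow_descents (k : Type*) [CommRing k] (w : Equiv.Perm (Fin n)) :
    ∑ α : Composition n with descents w ⊆ innerBoundaries α, (-1 : k) ^ (n - α.length) =
      if w = Fin.revPerm then 1 else 0 := by
  classical
  set D := (Finset.univ.filter fun i : Fin (n + 1) => 0 < i.val ∧ i.val < n) \ descents w with hD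
  have h1 : ∑ α : Composition n with descents w ⊆ innerBoundaries α, (-1 : k) ^ (n - α.length) =
      ∑ J ∈ D.powerset, (-1 : k) ^ J.card := by
    -- The boundaries include `0` and `n`, so the complement consists of interior positions; its
    -- size is `(n + 1) - (α.length + 1)`.
    refine Finset.sum_bij (fun α _ => α.boundariesᶜ) ?_ ?_ ?_ ?_
    · intro α hα
      have hα := (Finset.mem_filter.1 hα).2
      rw [Finset.mem_powerset]
      intro i hi
      rw [Finset.mem_compl] at hi
      simp only [hD, Finset.mem_sdiff, Finset.mem_filter, Finset.mem_univ, true_and]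
      refine ⟨⟨?_, ?_⟩, fun h => hi (mem_innerBoundaries.1 (hα h)).1⟩
      · by_contra h
        have : i = 0 := Fin.ext (Nat.eq_zero_of_not_pos h)
        subst this
        exact hi α.toCompositionAsSet.zero_mem
      · by_contra h
        have : i = Fin.last n := Fin.ext (by simp; omega)
        subst this
        exact hi α.toCompositionAsSet.getLast_mem
    · intro α _ β _ h
      apply innerBoundaries_injective
      rw [innerBoundaries, innerBoundaries, compl_injective h]
    · intro J hJ
      rw [Finset.mem_powerset] at hJ
      obtain ⟨α, hα⟩ := exists_innerBoundaries_eq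
        ((Finset.univ.filter fun i : Fin (n + 1) => 0 < i.val ∧ i.val < n) \ J)
        (fun i hi => by simpa using (Finset.mem_sdiff.1 hi).1)
      refine ⟨α, ?_, ?_⟩
      · simp only [Finset.mem_filter, Finset.mem_univ, true_and, hα]
        intro i hi
        simp only [Finset.mem_sdiff, Finset.mem_filter, Finset.mem_univ, true_and]
        refine ⟨?_, fun h => (Finset.mem_sdiff.1 (hJ h)).2 hi⟩
        obtain ⟨h0, h1, _⟩ := mem_descents.1 hi
        exact ⟨h0, h1⟩
      · ext i
        have hi := Finset.ext_iff.1 hα i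
        simp only [mem_innerBoundaries, Finset.mem_sdiff, Finset.mem_filter, Finset.mem_univ,
          true_and] at hi
        rw [Finset.mem_compl]
        constructor
        · intro h
          by_contra hiJ
          by_cases hb : 0 < i.val ∧ i.val < n
          · exact h (hi.2 ⟨hb, hiJ⟩).1
          · by_cases h0 : 0 < i.val
            · have : i = Fin.last n := Fin.ext (by simp; omega)
              subst this
              exact h α.toCompositionAsSet.getLast_mem
            · have : i = 0 := Fin.ext (Nat.eq_zero_of_not_pos h0)
              subst this
              exact h α.toCompositionAsSet.zero_mem
        · intro h h'
          have := (Finset.mem_sdiff.1 (hJ h)).1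
          rw [Finset.mem_filter] at this
          exact (hi.1 ⟨h', this.2⟩).2 h
    · intro α _
      rw [card_compl_boundaries]
  have h2 := congrArg (Int.cast : ℤ → k) (Finset.sum_powerset_neg_one_pow_card (x := D))
  rw [h1]
  push_cast at h2
  rw [h2]
  refine if_congr ?_ rfl rfl
  rw [hD, Finset.sdiff_eq_empty_iff_subset]
  constructor
  · intro h
    exact eq_revPerm_of_descents fun i hi => h (by simpa using hi)
  · rintro rfl i hi
    rw [mem_descents_revPerm]
    simpa using hi

theorem longest_eq_sum (k : Type*) [CommRing k] (n : ℕ) :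
    longest k n = ∑ α : Composition n, (-1 : k) ^ (n - α.length) • descentB k α := by
  classical
  refine MonoidAlgebra.ext (Finsupp.ext fun w => ?_)
  have h := sum_neg_one_pow_descents k w
  rw [Finset.sum_filter] at h
  simp only [coeff_sum, Finsupp.finsetSum_apply, coeff_smul, Finsupp.smul_apply, descentB,
    coeff_descentBSet, smul_eq_mul, mul_ite, mul_one, mul_zero, h]
  rw [longest, of_apply, coeff_single, Finsupp.single_apply]
  simp only [eq_comm]

theorem length_type (F : Face n) : F.type.length = F.length := by
  simp [Composition.length, Face.type, Face.length]

theorem longestTilde_eq_sum_faces (k : Type*) [CommRing k] (n : ℕ) :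
    longestTilde k n = ∑ F : Face n, (-1 : k) ^ (n - F.length) • of k _ F := by
  have h : (⟨longest k n, longest_mem k n⟩ : descentAlgebra k n) =
      ∑ α : Composition n, (-1 : k) ^ (n - α.length) •
        (⟨descentB k α, Submodule.subset_span ⟨α, rfl⟩⟩ : descentAlgebra k n) := by
    apply Subtype.ext
    simp [longest_eq_sum]
  rw [longestTilde, h, map_sum, ← Finset.sum_fiberwise (s := Finset.univ) (g := Face.type)]
  refine Finset.sum_congr rfl fun α _ => ?_
  rw [map_smul, rho_descentB, faceB, Finset.smul_sum]
  refine Finset.sum_congr rfl fun F hF => ?_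
  rw [← length_type, (Finset.mem_filter.1 hF).2]

variable {k : Type*} [Field k] [CharZero k]

theorem longestTilde_eq_chooseSum (n : ℕ) :
    longestTilde k n = (-1 : k) ^ n • chooseSum n (-1 : k) := by
  rw [longestTilde_eq_sum_faces, chooseSum, Finset.smul_sum]
  refine Finset.sum_congr rfl fun F _ => ?_
  have hF : F.length ≤ n := length_type F ▸ F.type.length_le
  rw [choosePoly_eval_neg_one, smul_smul, ← pow_add]
  congr 1
  -- Natural subtraction is exact here since a face has at most `n` blocks.
  rw [show n + F.length = (n - F.length) + (F.length + F.length) by omega, pow_add,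
    Even.neg_one_pow ⟨_, rfl⟩, mul_one]

theorem longestTilde_mul_self (n : ℕ) : longestTilde k n * longestTilde k n = 1 := by
  rw [longestTilde_eq_chooseSum, smul_mul_smul_comm, chooseSum_mul_chooseSum, neg_mul_neg, one_mul,
    chooseSum_one, ← mul_pow]
  simp

theorem coeff_of_mul_longestTilde (F : Face n) :
    (of k _ F * longestTilde k n).coeff F = (-1) ^ (n - F.length) := by
  have hF : F.length ≤ n := length_type F ▸ F.type.length_le
  rw [longestTilde_eq_chooseSum, mul_smul_comm, coeff_smul, Finsupp.smul_apply,
    coeff_of_mul_chooseSum, smul_eq_mul, ← pow_add,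
    show n + F.length = (n - F.length) + (F.length + F.length) by omega, pow_add,
    Even.neg_one_pow ⟨_, rfl⟩, mul_one]

end Longest

end FaceAlg
end

noncomputable section

namespace FaceAlg

open MonoidAlgebra (of)

/-! ### Right ideals of the face monoid -/

section Support

variable {k : Type*} [CommRing k] {n : ℕ}

/-- The elements of the face algebra that are supported on `U`. -/
def supportedOn (k : Type*) [CommRing k] {n : ℕ} (U : Set (Face n)) :
    Submodule k (FaceAlgebra k n) where
  carrier := {x | ∀ H ∉ U, x.coeff H = 0}
  zero_mem' := by simp
  add_mem' := by
    intro x y hx hy H hH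
    rw [MonoidAlgebra.coeff_add, Finsupp.add_apply, hx H hH, hy H hH, add_zero]
  smul_mem' := by
    intro c x hx H hH
    rw [MonoidAlgebra.coeff_smul, Finsupp.smul_apply, hx H hH, smul_zero]

theorem coeff_of [DecidableEq (Face n)] (F H : Face n) :
    (of k _ F).coeff H = if F = H then 1 else 0 := by
  rw [MonoidAlgebra.of_apply, MonoidAlgebra.coeff_single, Finsupp.single_apply]

theorem of_mem_supportedOn {U : Set (Face n)} {F : Face n} (hF : F ∈ U) :
    of k _ F ∈ supportedOn k U := by
  classical
  intro H hH
  rw [coeff_of, if_neg]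
  rintro rfl
  exact hH hF

theorem eq_sum_coeff_smul_of (x : FaceAlgebra k n) :
    x = ∑ F : Face n, x.coeff F • of k _ F := by
  classical
  refine MonoidAlgebra.ext (Finsupp.ext fun H => ?_)
  simp only [MonoidAlgebra.coeff_sum, Finsupp.finsetSum_apply, MonoidAlgebra.coeff_smul,
    Finsupp.smul_apply, coeff_of, smul_eq_mul, mul_ite, mul_one, mul_zero, Finset.sum_ite_eq',
    Finset.mem_univ, if_true]

theorem supportedOn_le {U : Set (Face n)} {W : Submodule k (FaceAlgebra k n)}
    (h : ∀ F ∈ U, of k _ F ∈ W) : supportedOn k U ≤ W := by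
  intro x hx
  rw [eq_sum_coeff_smul_of x]
  refine Submodule.sum_mem _ fun F _ => ?_
  by_cases hF : F ∈ U
  · exact W.smul_mem _ (h F hF)
  · rw [hx F hF, zero_smul]
    exact W.zero_mem

theorem mul_mem_supportedOn {U : Set (Face n)} (hU : ∀ F ∈ U, ∀ G, F * G ∈ U)
    {x : FaceAlgebra k n} (hx : x ∈ supportedOn k U) (y : FaceAlgebra k n) :
    x * y ∈ supportedOn k U := by
  suffices h : supportedOn k U ≤ (supportedOn k U).comap (LinearMap.mulRight k y) from h hx
  refine supportedOn_le fun F hF => ?_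
  rw [Submodule.mem_comap, LinearMap.mulRight_apply, eq_sum_coeff_smul_of y, Finset.mul_sum]
  refine Submodule.sum_mem _ fun G _ => ?_
  rw [mul_smul_comm, ← map_mul]
  exact Submodule.smul_mem _ _ (of_mem_supportedOn (hU F hF G))

theorem of_mul_sub_mem_supportedOn (F : Face n) (x : FaceAlgebra k n) :
    of k _ F * x - (of k _ F * x).coeff F • of k _ F ∈
      supportedOn k {H : Face n | H.sameBlock.ncard < F.sameBlock.ncard} := by
  classical
  induction x using MonoidAlgebra.induction_on with
  | of G =>
    rw [← map_mul, coeff_of]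
    split_ifs with h
    · rw [h, one_smul, sub_self]
      exact Submodule.zero_mem _
    · rw [zero_smul, sub_zero]
      exact of_mem_supportedOn (Face.ncard_sameBlock_mul_lt h)
  | add x y hx hy =>
    convert Submodule.add_mem _ hx hy using 1
    rw [mul_add, MonoidAlgebra.coeff_add, Finsupp.add_apply, add_smul]
    abel
  | smul r x hx =>
    convert Submodule.smul_mem _ r hx using 1
    rw [mul_smul_comm, MonoidAlgebra.coeff_smul, Finsupp.smul_apply, smul_eq_mul, mul_smul,
      smul_sub]

theorem coeff_of_mul_eq_zero {F H : Face n} (x : FaceAlgebra k n) (hne : H ≠ F)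
    (hle : F.sameBlock.ncard ≤ H.sameBlock.ncard) : (of k _ F * x).coeff H = 0 := by
  classical
  have h := of_mul_sub_mem_supportedOn F x H (by simpa using hle)
  rwa [MonoidAlgebra.coeff_sub, Finsupp.sub_apply, MonoidAlgebra.coeff_smul, Finsupp.smul_apply,
    coeff_of, if_neg hne.symm, smul_zero, sub_zero] at h

/-- Modulo faces with fewer same-block pairs, `F * x` is a multiple of `F`. Those faces form a right
ideal not containing `F`, so multiplying the error by `y` contributes nothing at `F`. -/
theorem coeff_of_mul_mul (F : Face n) (x y : FaceAlgebra k n) :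
    (of k _ F * (x * y)).coeff F = (of k _ F * x).coeff F * (of k _ F * y).coeff F := by
  have hU : ∀ H ∈ {H : Face n | H.sameBlock.ncard < F.sameBlock.ncard}, ∀ G,
      H * G ∈ {H : Face n | H.sameBlock.ncard < F.sameBlock.ncard} := by
    intro H hH G
    by_cases h : H * G = H
    · rwa [h]
    · exact (Face.ncard_sameBlock_mul_lt h).trans hH
  have h := mul_mem_supportedOn hU (of_mul_sub_mem_supportedOn F x) y F (by simp)
  rw [sub_mul, smul_mul_assoc, mul_assoc, MonoidAlgebra.coeff_sub, Finsupp.sub_apply,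
    MonoidAlgebra.coeff_smul, Finsupp.smul_apply, smul_eq_mul, sub_eq_zero] at h
  exact h

end Support

/-! ### Weighted knapsack numbers -/

section Knapsack

variable {k : Type*} [CommRing k] {n : ℕ}

/-- The `γ`-weighted knapsack number `∑_α γ_α n_α(F)`. -/
def weightedKnapsack (γ : Composition n → k) (F : Face n) : k :=
  ∑ α : Composition n, γ α * (knapsack α F : k)

theorem weightedSignedKnapsack_eq (γ : Composition n → k) (F : Face n) :
    weightedSignedKnapsack γ F = (-1) ^ (n - F.length) * weightedKnapsack γ F := by
  rw [weightedSignedKnapsack, weightedKnapsack, Finset.mul_sum]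
  refine Finset.sum_congr rfl fun α _ => ?_
  rw [signedKnapsack]
  push_cast
  ring

open Classical in
theorem weightedKnapsack_eq_sum (γ : Composition n → k) (F : Face n) :
    weightedKnapsack γ F = ∑ G : Face n with F.Contained G, γ G.type := by
  rw [weightedKnapsack, ← Finset.sum_fiberwise (g := Face.type)]
  refine Finset.sum_congr rfl fun α _ => ?_
  rw [Finset.filter_filter, Finset.sum_congr rfl
    (g := fun _ => γ α) fun G hG => by rw [(Finset.mem_filter.1 hG).2.2],
    Finset.sum_const, nsmul_eq_mul, mul_comm, knapsack, Nat.card_eq_fintype_card,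
    Fintype.card_subtype]

theorem faceBWeighted_eq_sum (γ : Composition n → k) :
    faceBWeighted γ = ∑ G : Face n, γ G.type • of k _ G := by
  rw [faceBWeighted, ← Finset.sum_fiberwise (s := Finset.univ) (g := Face.type)]
  refine Finset.sum_congr rfl fun α _ => ?_
  rw [faceB, Finset.smul_sum]
  exact Finset.sum_congr rfl fun G hG => by rw [(Finset.mem_filter.1 hG).2]

theorem of_mul_faceBWeighted (γ : Composition n → k) (F : Face n) :
    of k _ F * faceBWeighted γ = ∑ G : Face n, γ G.type • of k _ (F * G) := by
  simp only [faceBWeighted_eq_sum, Finset.mul_sum, mul_smul_comm, map_mul]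

theorem coeff_of_mul_faceBWeighted (γ : Composition n → k) (F : Face n) :
    (of k _ F * faceBWeighted γ).coeff F = weightedKnapsack γ F := by
  classical
  rw [of_mul_faceBWeighted, weightedKnapsack_eq_sum, Finset.sum_filter, MonoidAlgebra.coeff_sum,
    Finsupp.finsetSum_apply]
  refine Finset.sum_congr rfl fun G _ => ?_
  rw [MonoidAlgebra.coeff_smul, Finsupp.smul_apply, coeff_of, smul_eq_mul, mul_ite, mul_one,
    mul_zero]
  exact if_congr Face.mul_eq_left_iff_contained rfl rfl

variable [LinearOrder k] [IsStrictOrderedRing k] {γ : Composition n → k}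

theorem weightedKnapsack_nonneg (hγ : ∀ α, 0 ≤ γ α) (F : Face n) : 0 ≤ weightedKnapsack γ F :=
  Finset.sum_nonneg fun _ _ => mul_nonneg (hγ _) (Nat.cast_nonneg _)

theorem weightedKnapsack_le_mul (hγ : ∀ α, 0 ≤ γ α) (F G : Face n) :
    weightedKnapsack γ F ≤ weightedKnapsack γ (F * G) := by
  classical
  rw [weightedKnapsack_eq_sum, weightedKnapsack_eq_sum]
  refine Finset.sum_le_sum_of_subset_of_nonneg (fun H hH => ?_) fun _ _ _ => hγ _
  rw [Finset.mem_filter] at hH ⊢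
  exact ⟨hH.1, hH.2.mul_right G⟩

/-- The strict gain comes from `G` itself, which contains `F * G` but not `F`. -/
theorem weightedKnapsack_lt_mul (hγ : ∀ α, 0 ≤ γ α) {F G : Face n} (hG : γ G.type ≠ 0)
    (h : F * G ≠ F) : weightedKnapsack γ F < weightedKnapsack γ (F * G) := by
  classical
  rw [weightedKnapsack_eq_sum, weightedKnapsack_eq_sum]
  refine Finset.sum_lt_sum_of_subset (i := G) (fun H hH => ?_) ?_ ?_ ((hγ _).lt_of_ne' hG)
    fun _ _ _ => hγ _
  · rw [Finset.mem_filter] at hH ⊢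
    exact ⟨hH.1, hH.2.mul_right G⟩
  · exact Finset.mem_filter.2 ⟨Finset.mem_univ _, Face.mul_contained_right F G⟩
  · intro hF
    exact h (Face.mul_eq_left_iff_contained.2 (Finset.mem_filter.1 hF).2)

/-- The faces `G` containing `F` account for the scalar part; every other `G` either has weight zero
or strictly raises the knapsack number. -/
theorem of_mul_faceBWeighted_sub_mem (hγ : ∀ α, 0 ≤ γ α) (F : Face n) :
    of k _ F * faceBWeighted γ - weightedKnapsack γ F • of k _ F ∈
      supportedOn k {H : Face n | weightedKnapsack γ F < weightedKnapsack γ H} := by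
  classical
  have hsum : of k _ F * faceBWeighted γ - weightedKnapsack γ F • of k _ F =
      ∑ G : Face n, (γ G.type • of k _ (F * G) -
        (if F.Contained G then γ G.type else 0) • of k _ F) := by
    rw [of_mul_faceBWeighted, weightedKnapsack_eq_sum, Finset.sum_filter, Finset.sum_smul,
      Finset.sum_sub_distrib]
  rw [hsum]
  refine Submodule.sum_mem _ fun G _ => ?_
  split_ifs with h
  · rw [Face.mul_eq_left_iff_contained.2 h, sub_self]
    exact Submodule.zero_mem _
  · rw [zero_smul, sub_zero]
    by_cases hG : γ G.type = 0
    · rw [hG, zero_smul]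
      exact Submodule.zero_mem _
    · refine Submodule.smul_mem _ _ (of_mem_supportedOn ?_)
      exact weightedKnapsack_lt_mul hγ hG fun h' => h (Face.mul_eq_left_iff_contained.1 h')

theorem mul_mem_supportedOn_ge (hγ : ∀ α, 0 ≤ γ α) {c : k} {x : FaceAlgebra k n}
    (hx : x ∈ supportedOn k {H : Face n | c ≤ weightedKnapsack γ H}) (y : FaceAlgebra k n) :
    x * y ∈ supportedOn k {H : Face n | c ≤ weightedKnapsack γ H} :=
  mul_mem_supportedOn (fun F (hF : c ≤ weightedKnapsack γ F) G =>
    hF.trans (weightedKnapsack_le_mul hγ F G)) hx y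

theorem mul_mem_supportedOn_gt (hγ : ∀ α, 0 ≤ γ α) {c : k} {x : FaceAlgebra k n}
    (hx : x ∈ supportedOn k {H : Face n | c < weightedKnapsack γ H}) (y : FaceAlgebra k n) :
    x * y ∈ supportedOn k {H : Face n | c < weightedKnapsack γ H} :=
  mul_mem_supportedOn (fun F (hF : c < weightedKnapsack γ F) G =>
    hF.trans_le (weightedKnapsack_le_mul hγ F G)) hx y

theorem mul_faceBWeighted_sub_mem (hγ : ∀ α, 0 ≤ γ α) {c : k} {x : FaceAlgebra k n}
    (hx : x ∈ supportedOn k {H : Face n | c ≤ weightedKnapsack γ H}) :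
    x * faceBWeighted γ - c • x ∈ supportedOn k {H : Face n | c < weightedKnapsack γ H} := by
  suffices h : supportedOn k {H : Face n | c ≤ weightedKnapsack γ H} ≤
      (supportedOn k {H : Face n | c < weightedKnapsack γ H}).comap
        (LinearMap.mulRight k (faceBWeighted γ) - c • LinearMap.id) from h hx
  refine supportedOn_le fun F hF => ?_
  simp only [Submodule.mem_comap, LinearMap.sub_apply, LinearMap.mulRight_apply,
    LinearMap.smul_apply, LinearMap.id_apply]
  rcases (show c ≤ weightedKnapsack γ F from hF).eq_or_lt with rfl | hlt
  · exact of_mul_faceBWeighted_sub_mem hγ F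
  · have h := of_mem_supportedOn (k := k) (U := {H : Face n | c < weightedKnapsack γ H}) hlt
    exact Submodule.sub_mem _ (mul_mem_supportedOn_gt hγ h _) (Submodule.smul_mem _ _ h)

end Knapsack

/-! ### The operator `x ↦ x w̃₀ B̃_γ` -/

section Operator

open Polynomial

/-- Distinct linear factors are coprime, so the kernel of their product is the sum of the
eigenspaces; a basis is then extracted from the spanning set of eigenvectors. -/
theorem isDiagonalizable_of_aeval_prod_eq_zero {k : Type*} {V : Type*} [Field k] [AddCommGroup V]
    [Module k V] (f : Module.End k V) (S : Finset k) (h : aeval f (∏ r ∈ S, (X - C r)) = 0) :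
    IsDiagonalizable f := by
  classical
  set s : Set V := {v | ∃ c : k, f v = c • v} with hs
  have key : ∀ S : Finset k,
      LinearMap.ker (aeval f (∏ r ∈ S, (X - C r))) ≤ Submodule.span k s := by
    intro S
    induction S using Finset.induction_on with
    | empty =>
      intro v hv
      have : v = 0 := by simpa using hv
      rw [this]
      exact Submodule.zero_mem _
    | insert r S hr ih =>
      rw [Finset.prod_insert hr, ← sup_ker_aeval_eq_ker_aeval_mul_of_coprime]
      · refine sup_le (fun v hv => Submodule.subset_span ⟨r, ?_⟩) ih
        simpa [sub_eq_zero, Module.algebraMap_end_apply] using hv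
      · refine IsCoprime.prod_right fun i hi => ?_
        exact pairwise_coprime_X_sub_C Function.injective_id fun h' => hr (h' ▸ hi)
  have htop : ⊤ ≤ Submodule.span k s := by
    have := key S
    rwa [h, LinearMap.ker_zero] at this
  refine ⟨_, Module.Basis.ofSpan htop, fun i => ?_⟩
  exact Module.Basis.ofSpan_subset htop ⟨i, rfl⟩

variable {k : Type*} [Field k] {n : ℕ}

theorem rightMulOperator_apply (γ : Composition n → k) (x : FaceAlgebra k n) :
    rightMulOperator γ x = x * longestTilde k n * faceBWeighted γ := by
  rw [rightMulOperator, LinearMap.mulRight_apply, mul_assoc]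

theorem charpoly_rightMulOperator [CharZero k] (γ : Composition n → k) :
    (rightMulOperator γ).charpoly = ∏ F : Face n, (X - C (weightedSignedKnapsack γ F)) := by
  classical
  -- Faces are ordered by their number of same-block pairs. Ties are broken by an arbitrary
  -- numbering, since the coefficients between distinct tied faces vanish.
  let : LinearOrder (Face n) := LinearOrder.lift'
    (fun F => toLex (F.sameBlock.ncard, Fintype.equivFin (Face n) F)) fun F G h => by
      simpa using congrArg (fun p => (ofLex p).2) h
  let b : Module.Basis (Face n) k (FaceAlgebra k n) := MonoidAlgebra.basis (Face n) k
  have hM : ∀ H F, LinearMap.toMatrix b b (rightMulOperator γ) H F =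
      (of k _ F * (longestTilde k n * faceBWeighted γ)).coeff H := by
    intro H F
    rw [LinearMap.toMatrix_apply]
    rfl
  rw [← LinearMap.charpoly_toMatrix _ b, Matrix.charpoly_of_isUpperTriangular]
  · refine Finset.prod_congr rfl fun F _ => ?_
    rw [hM, coeff_of_mul_mul, coeff_of_mul_longestTilde, coeff_of_mul_faceBWeighted,
      weightedSignedKnapsack_eq]
  · intro H F hlt
    rw [hM]
    have hlt' : toLex (F.sameBlock.ncard, Fintype.equivFin (Face n) F) <
      toLex (H.sameBlock.ncard, Fintype.equivFin (Face n) H) := hlt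
    refine coeff_of_mul_eq_zero _ (ne_of_gt hlt) ?_
    rw [Prod.Lex.toLex_lt_toLex] at hlt'
    rcases hlt' with h | h
    · exact h.le
    · exact h.1.le

variable [LinearOrder k] [IsStrictOrderedRing k] {γ : Composition n → k}

theorem rightMulOperator_sub_mem (hγ : ∀ α, 0 ≤ γ α) {c : k} {x : FaceAlgebra k n}
    (hx : x ∈ supportedOn k {H : Face n | c ≤ weightedKnapsack γ H}) :
    rightMulOperator γ x - c • (x * longestTilde k n) ∈
      supportedOn k {H : Face n | c < weightedKnapsack γ H} := by
  rw [rightMulOperator_apply]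
  exact mul_faceBWeighted_sub_mem hγ (mul_mem_supportedOn_ge hγ hx _)

theorem rightMulOperator_sq_sub_mem (hγ : ∀ α, 0 ≤ γ α) {c : k} {x : FaceAlgebra k n}
    (hx : x ∈ supportedOn k {H : Face n | c ≤ weightedKnapsack γ H}) :
    rightMulOperator γ (rightMulOperator γ x) - (c * c) • x ∈
      supportedOn k {H : Face n | c < weightedKnapsack γ H} := by
  set T := rightMulOperator γ with hT
  set w := longestTilde k n with hw
  have hTx : T x ∈ supportedOn k {H : Face n | c ≤ weightedKnapsack γ H} := by
    rw [hT, rightMulOperator, LinearMap.mulRight_apply]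
    exact mul_mem_supportedOn_ge hγ hx _
  have h1 := rightMulOperator_sub_mem hγ hTx
  have h2 := Submodule.smul_mem _ c
    (mul_mem_supportedOn_gt hγ (rightMulOperator_sub_mem hγ hx) w)
  -- With `w * w = 1`: `T(Tx) - c²x = (T(Tx) - c(Tx)w) + c(Tx - cxw)w`.
  convert Submodule.add_mem _ h1 h2 using 1
  rw [← hT, ← hw, sub_mul, smul_mul_assoc, mul_assoc x, hw, longestTilde_mul_self, mul_one,
    smul_sub, smul_smul]
  abel

/-- For `c = 0` the finset `{c, -c}` collapses to one element and the single factor `X` suffices, so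
no root is repeated. -/
theorem aeval_prod_pair_mem (hγ : ∀ α, 0 ≤ γ α) {c : k} {x : FaceAlgebra k n}
    (hx : x ∈ supportedOn k {H : Face n | c ≤ weightedKnapsack γ H}) :
    aeval (rightMulOperator γ) (∏ r ∈ {c, -c}, (X - C r)) x ∈
      supportedOn k {H : Face n | c < weightedKnapsack γ H} := by
  by_cases hc : c = 0
  · have h := rightMulOperator_sub_mem hγ hx
    rw [hc, zero_smul, sub_zero] at h
    rw [hc]
    simpa using h
  · have hne : c ≠ -c := fun h => hc (self_eq_neg.1 h)
    have hp : (X - C c) * (X - C (-c)) = X * X - C (c * c) := by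
      rw [C_neg, C_mul]
      ring
    rw [Finset.prod_pair hne, hp]
    simpa [Module.algebraMap_end_apply, mul_smul] using rightMulOperator_sq_sub_mem hγ hx

theorem isDiagonalizable_rightMulOperator (hγ : ∀ α, 0 ≤ γ α) :
    IsDiagonalizable (rightMulOperator γ) := by
  classical
  set N := weightedKnapsack γ with hN
  have hN0 : ∀ F, 0 ≤ N F := weightedKnapsack_nonneg hγ
  -- `S` may contain values that are not eigenvalues; an annihilating polynomial with simple roots
  -- is all that is needed.
  set S : Finset k := Finset.univ.image N ∪ Finset.univ.image (fun F => -N F) with hS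
  let P : Finset k → Module.End k (FaceAlgebra k n) := fun R =>
    aeval (rightMulOperator γ) (∏ r ∈ R, (X - C r))
  have hsub : ∀ {R R' : Finset k}, R ⊆ R' → ∀ {x}, P R x = 0 → P R' x = 0 := by
    intro R R' h x hx
    change aeval (rightMulOperator γ) _ _ = 0
    rw [← Finset.prod_sdiff h, map_mul, Module.End.mul_apply]
    exact (congrArg _ hx).trans (map_zero _)
  -- Descent along the filtration: the factors `±N F` send `F` into the span of faces with larger
  -- `N`, and the factors with larger `|r|` kill those by induction on the number of such faces.
  have key : ∀ m : ℕ, ∀ F : Face n, (Finset.univ.filter fun G => N F < N G).card = m →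
      P (S.filter fun r => N F ≤ |r|) (of k _ F) = 0 := by
    intro m
    induction m using Nat.strong_induction_on with
    | _ m ih =>
      intro F hF
      have hsplit : (S.filter fun r => N F ≤ |r|) =
          (S.filter fun r => N F < |r|) ∪ {N F, -N F} := by
        ext r
        simp only [Finset.mem_union, Finset.mem_filter, Finset.mem_insert, Finset.mem_singleton]
        constructor
        · rintro ⟨hr, h⟩
          rcases h.eq_or_lt with h | h
          · exact Or.inr ((abs_eq (hN0 F)).1 h.symm)
          · exact Or.inl ⟨hr, h⟩
        · rintro (⟨hr, h⟩ | rfl | rfl)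
          · exact ⟨hr, h.le⟩
          · exact ⟨Finset.mem_union_left _ (Finset.mem_image_of_mem _ (Finset.mem_univ _)),
              le_abs_self _⟩
          · exact ⟨Finset.mem_union_right _
              (Finset.mem_image_of_mem (fun F => -N F) (Finset.mem_univ _)),
              abs_neg (N F) ▸ le_abs_self (N F)⟩
      have hdisj : Disjoint (S.filter fun r => N F < |r|) {N F, -N F} := by
        rw [Finset.disjoint_left]
        intro r hr hr'
        have h := (Finset.mem_filter.1 hr).2
        rw [Finset.mem_insert, Finset.mem_singleton] at hr'
        rw [(abs_eq (hN0 F)).2 hr'] at h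
        exact lt_irrefl _ h
      have hle : supportedOn k {H : Face n | N F < N H} ≤
          LinearMap.ker (P (S.filter fun r => N F < |r|)) := by
        refine supportedOn_le fun G hG => ?_
        have hG' : N F < N G := hG
        rw [LinearMap.mem_ker]
        refine hsub (fun r hr => ?_) (ih _ ?_ G rfl)
        · rw [Finset.mem_filter] at hr ⊢
          exact ⟨hr.1, hG'.trans_le hr.2⟩
        · rw [← hF]
          refine Finset.card_lt_card (Finset.ssubset_iff_of_subset ?_ |>.2
            ⟨G, by simpa using hG', by simp⟩)
          intro H hH
          rw [Finset.mem_filter] at hH ⊢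
          exact ⟨hH.1, hG'.trans hH.2⟩
      have hmem := aeval_prod_pair_mem hγ (c := N F) (x := of k _ F)
        (of_mem_supportedOn (le_refl (N F)))
      change aeval (rightMulOperator γ) _ _ = 0
      rw [hsplit, Finset.prod_union hdisj, map_mul, Module.End.mul_apply]
      exact hle hmem
  refine isDiagonalizable_of_aeval_prod_eq_zero _ S ?_
  refine (MonoidAlgebra.basis (Face n) k).ext fun F => ?_
  exact hsub (Finset.filter_subset _ _) (key _ F rfl)

end Operator

end FaceAlg
end

theorem mainTheorem7 {k : Type*} [Field k] [LinearOrder k] [IsStrictOrderedRing k] (n : ℕ)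
    (γ : Composition n → k) (hγ : ∀ α, 0 ≤ γ α) :
    FaceAlg.IsDiagonalizable (FaceAlg.rightMulOperator γ) ∧
    (∀ c : k, Module.End.HasEigenvalue (FaceAlg.rightMulOperator γ) c ↔
      ∃ F : FaceAlg.Face n, FaceAlg.weightedSignedKnapsack γ F = c) ∧
    (∀ c : k, (LinearMap.charpoly (FaceAlg.rightMulOperator γ)).rootMultiplicity c =
      Nat.card {F : FaceAlg.Face n // FaceAlg.weightedSignedKnapsack γ F = c}) := by
  classical
  refine ⟨FaceAlg.isDiagonalizable_rightMulOperator hγ, fun c => ?_, fun c => ?_⟩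
  · rw [Module.End.hasEigenvalue_iff_isRoot_charpoly, FaceAlg.charpoly_rightMulOperator,
      Polynomial.IsRoot.def, Polynomial.eval_prod, Finset.prod_eq_zero_iff]
    simp [sub_eq_zero, eq_comm]
  · have hroots : (∏ F : FaceAlg.Face n,
        (Polynomial.X - Polynomial.C (FaceAlg.weightedSignedKnapsack γ F))).roots =
        Finset.univ.val.map (FaceAlg.weightedSignedKnapsack γ) := by
      refine Eq.trans ?_ (Polynomial.roots_multiset_prod_X_sub_C _)
      rw [Multiset.map_map]
      rfl
    rw [FaceAlg.charpoly_rightMulOperator, ← Polynomial.count_roots, hroots, Multiset.count_map,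
      Nat.card_eq_fintype_card, Fintype.card_subtype]
    simp only [eq_comm]
    rfl
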